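/- Let $\varepsilon>0$, let $\Omega\subset\mathbb{R}^N$ be a bounded, convex domain (in particular open), equipped with the Euclidean distance and the $N$-dimensional Lebesgue measure, let $\mu$ be a probability measure on $\Omega\times\{0,1\}$, and assume that the measures $\varrho_i:=\mu(\,\cdot\times\{i\})$, $i\in\{0,1\}$, are absolutely continuous with respect to the Lebesgue measure; their densities are again denoted by $\varrho_i$. Write $B_\varepsilon(x)=\{y\in\mathbb{R}^N : |x-y|<\varepsilon\}$ and let $$\mathfrak{P}:=\Big\{\Psi\in L^1(\Omega\times\Omega)\ :\ \Psi\ge 0 \text{ a.e. on }\Omega\times\Omega,\quad \int_\Omega\Psi(x,y)\,dy=1 \text{ and } \operatorname{ess\,supp}\Psi(x,\cdot)\subset\overline{B_\varepsilon(x)}\cap\overline{\Omega}\ \text{ for a.e. }x\in\Omega\Big\},$$ where the essential support of a function on $\Omega$ is the complement in $\mathbb{R}^N$ of the largest open set $U$ such that the function vanishes a.e. on $U\cap\Omega$. Then for every $u\in L^\infty(\Omega)$ all integrals below are well defined and finite, $\mathfrak{P}$ is nonempty, and $$\int_\Omega \operatorname*{ess\,sup}_{B_\varepsilon(x)\cap\Omega}u\;\varrho_0(x)\,dx=\sup_{\Psi\in\mathfrak{P}}\int_\Omega\int_\Omega\Psi(x,y)\,\varrho_0(x)\,u(y)\,dy\,dx$$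 and $$\int_\Omega \operatorname*{ess\,inf}_{B_\varepsilon(x)\cap\Omega}u\;\varrho_1(x)\,dx=\inf_{\Psi\in\mathfrak{P}}\int_\Omega\int_\Omega\Psi(x,y)\,\varrho_1(x)\,u(y)\,dy\,dx,$$ where the essential supremum and infimum are taken with respect to the Lebesgue measure. -/

import Mathlib

namespace AdversarialTV

open MeasureTheory

/-- Essential support of `f` with respect to `ν`: the complement of the largest open set on which
`f` vanishes `ν`-almost everywhere. -/
def essSupport {X : Type*} [TopologicalSpace X] [MeasurableSpace X]
    (ν : Measure X) (f : X → ℝ) : Set X :=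
  (⋃₀ {U : Set X | IsOpen U ∧ ∀ᵐ y ∂(ν.restrict U), f y = 0})ᶜ

/-- The (un-normalized) conditional distribution `ϱ_i = μ(· × {i})` of a measure `μ` on
`Ω × {0, 1}`, regarded as a measure on the ambient space `ℝ^N`. -/
noncomputable def condDistr {N : ℕ} {Ω : Set (EuclideanSpace ℝ (Fin N))}
    (μ : Measure (Ω × Fin 2)) (i : Fin 2) : Measure (EuclideanSpace ℝ (Fin N)) :=
  (μ.restrict (Set.univ ×ˢ {i})).map (fun p => (p.1 : EuclideanSpace ℝ (Fin N)))

/-- The real-valued Lebesgue density of `ϱ_i`. -/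
noncomputable def density {N : ℕ} {Ω : Set (EuclideanSpace ℝ (Fin N))}
    (μ : Measure (Ω × Fin 2)) (i : Fin 2) (x : EuclideanSpace ℝ (Fin N)) : ℝ :=
  ((condDistr μ i).rnDeriv volume x).toReal

/-- The set of test functions. Elements of `L¹(Ω × Ω)` are represented by functions, and every
condition is invariant under changing the representative on a null set of `Ω × Ω`; accordingly
the conditions on the sections `Ψ(x, ·)` are imposed for almost every `x ∈ Ω`. -/
def testFunctions {N : ℕ} (Ω : Set (EuclideanSpace ℝ (Fin N))) (ε : ℝ) :
    Set (EuclideanSpace ℝ (Fin N) × EuclideanSpace ℝ (Fin N) → ℝ) :=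
  {Ψ | MemLp Ψ 1 ((volume.restrict Ω).prod (volume.restrict Ω)) ∧
    (∀ᵐ p ∂((volume.restrict Ω).prod (volume.restrict Ω)), 0 ≤ Ψ p) ∧
    (∀ᵐ x ∂(volume.restrict Ω), ∫ y in Ω, Ψ (x, y) = 1) ∧
    (∀ᵐ x ∂(volume.restrict Ω),
      essSupport (volume.restrict Ω) (fun y => Ψ (x, y)) ⊆ Metric.closedBall x ε ∩ closure Ω)}

end AdversarialTV

/-!
Averaging `u` against a probability density `Ψ(x, ·)` that vanishes off a set `A_x` never exceeds
`S(x) = ess sup_{A_x} u`. Conversely, `{y ∈ A_x | u y > S(x) - δ}` has positive measure by the very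
definition of `S(x)`, and averaging `u` over the uniform distribution on that set comes within `δ`
of `S(x)`; integrating against `ρ` and letting `δ → 0` gives the supremum formula. These uniform
distributions form a jointly measurable `Ψ` because `x ↦ S(x)` is measurable: `t < S(x)` means that
`{y ∈ A_x | u y > t}` is not null, and the measure of the sections of a measurable set depends
measurably on the base point. The infimum formula is the supremum formula for `-u`. None of this
uses balls; for `A_x = B_ε(x)`, spheres are null sets, so confining the essential support of
`Ψ(x, ·)` to the closed ball amounts to vanishing a.e. off the open one.
-/

namespace AdversarialTV

open MeasureTheory Filter Set
open scoped ENNReal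

section EssSup

variable {Y : Type*} [MeasurableSpace Y] {ν : Measure Y}

theorem essSup_neg_eq_neg_essInf (u : Y → ℝ) (ν : Measure Y) :
    essSup (-u) ν = -essInf u ν := by
  rw [essSup_eq_sInf, essInf_eq_sSup, ← Real.sInf_neg]
  congr 1
  ext a
  simp only [Pi.neg_apply, mem_ofPred_eq, Set.mem_neg, lt_neg]

theorem lt_essSup_iff_frequently {β : Type*} [ConditionallyCompleteLinearOrder β]
    [TopologicalSpace β] [FirstCountableTopology β] [OrderTopology β] {f : Y → β}
    (hco : IsCoboundedUnder (· ≤ ·) (ae ν) f) (hbdd : IsBoundedUnder (· ≤ ·) (ae ν) f) {t : β} :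
    t < essSup f ν ↔ ∃ᵐ y ∂ν, t < f y := by
  refine ⟨frequently_lt_of_lt_limsup hco, fun hfreq => ?_⟩
  obtain ⟨y, hty, hy⟩ := (hfreq.and_eventually (ae_le_essSup hbdd)).exists
  exact hty.trans_le hy

theorem isBoundedUnder_abs_of_memLp_top {u : Y → ℝ} (hu : MemLp u ∞ ν) :
    IsBoundedUnder (· ≤ ·) (ae ν) fun y => |u y| :=
  ⟨lpNorm u ∞ ν, eventually_map.2 (ae_le_lpNorm_exponent_top hu)⟩

theorem abs_essSup_le_of_ae_abs_le {u : Y → ℝ} {C : ℝ} (hν : ν ≠ 0) (hC : ∀ᵐ y ∂ν, |u y| ≤ C) :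
    |essSup u ν| ≤ C := by
  have : (ae ν).NeBot := ae_neBot.2 hν
  obtain ⟨hle, hge⟩ := isBoundedUnder_le_abs.1 ⟨C, eventually_map.2 hC⟩
  refine abs_le.2 ⟨?_, essSup_le_of_ae_le C (hC.mono fun y hy => (abs_le.1 hy).2)
    hge.isCoboundedUnder_le⟩
  exact le_limsup_of_frequently_le (hC.mono fun y hy => (abs_le.1 hy).1).frequently hle

theorem lt_essSup_restrict_iff {u : Y → ℝ} {s : Set Y} (hu : MemLp u ∞ ν) (hs : MeasurableSet s)
    (hνs : ν s ≠ 0) {t : ℝ} :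
    t < essSup u (ν.restrict s) ↔ ν (s ∩ {y | t < u y}) ≠ 0 := by
  have : (ae (ν.restrict s)).NeBot := ae_neBot.2 (Measure.restrict_eq_zero.not.2 hνs)
  obtain ⟨hle, hge⟩ :=
    isBoundedUnder_le_abs.1 (isBoundedUnder_abs_of_memLp_top (hu.restrict s))
  rw [lt_essSup_iff_frequently hge.isCoboundedUnder_le hle, frequently_ae_iff,
    Measure.restrict_apply' hs, inter_comm]

end EssSup

theorem integral_mul_le_of_integral_eq_one {Y : Type*} [MeasurableSpace Y] {ν : Measure Y}
    {f u : Y → ℝ} {c : ℝ} (hf : 0 ≤ᵐ[ν] f) (hf1 : ∫ y, f y ∂ν = 1)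
    (hfu : Integrable (fun y => f y * u y) ν) (hu : ∀ᵐ y ∂ν, f y ≠ 0 → u y ≤ c) :
    ∫ y, f y * u y ∂ν ≤ c := by
  calc
    ∫ y, f y * u y ∂ν ≤ ∫ y, f y * c ∂ν := by
      refine integral_mono_ae hfu ((integrable_of_integral_eq_one hf1).mul_const c) ?_
      filter_upwards [hf, hu] with y hfy huy
      by_cases hy : f y = 0
      · simp only [hy, zero_mul, le_refl]
      · exact mul_le_mul_of_nonneg_left (huy hy) hfy
    _ = c := by rw [integral_mul_const, hf1, one_mul]

section TransitionDensity

variable {X Y : Type*} [MeasurableSpace X] [MeasurableSpace Y] {κ : Measure X} {ν : Measure Y}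
  {A B : Set (X × Y)} {Ψ : X × Y → ℝ} {ρ c : X → ℝ} {u : Y → ℝ}

/-- `Ψ` is a density, with respect to `ν`, of a Markov kernel from `X` to `Y` whose measure at
almost every `x` is concentrated on the section `{y | (x, y) ∈ A}`. This is the measure-theoretic
form of the test functions: balls enter only through the choice of `A`. Integrability over
`κ.prod ν` is not required, so that `κ` may be infinite. -/
structure IsTransitionDensity (κ : Measure X) (ν : Measure Y) (A : Set (X × Y))
    (Ψ : X × Y → ℝ) : Prop where
  aestronglyMeasurable : AEStronglyMeasurable Ψ (κ.prod ν)
  nonneg : 0 ≤ᵐ[κ.prod ν] Ψ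
  integral_eq_one : ∀ᵐ x ∂κ, ∫ y, Ψ (x, y) ∂ν = 1
  mem_of_ne_zero : ∀ᵐ x ∂κ, ∀ᵐ y ∂ν, Ψ (x, y) ≠ 0 → (x, y) ∈ A

namespace IsTransitionDensity

theorem mono_ae (hΨ : IsTransitionDensity κ ν A Ψ)
    (hAB : ∀ᵐ x ∂κ, ∀ᵐ y ∂ν, (x, y) ∈ A → (x, y) ∈ B) : IsTransitionDensity κ ν B Ψ where
  __ := hΨ
  mem_of_ne_zero := by
    filter_upwards [hΨ.mem_of_ne_zero, hAB] with x hx hABx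
    filter_upwards [hx, hABx] with y hy hABy using hABy ∘ hy

variable [SFinite ν]

theorem integrable_mul_fst (hΨ : IsTransitionDensity κ ν A Ψ) (hρ : Integrable ρ κ) :
    Integrable (fun p => Ψ p * ρ p.1) (κ.prod ν) := by
  refine (integrable_prod_iff
    (hΨ.aestronglyMeasurable.mul hρ.aestronglyMeasurable.comp_fst)).2 ⟨?_, ?_⟩
  · filter_upwards [hΨ.integral_eq_one] with x hx
      using (integrable_of_integral_eq_one hx).mul_const (ρ x)
  · refine hρ.norm.congr ?_
    filter_upwards [Measure.ae_ae_of_ae_prod hΨ.nonneg, hΨ.integral_eq_one] with x hx0 hx1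
    have hnorm : ∫ y, ‖Ψ (x, y)‖ ∂ν = 1 :=
      (integral_congr_ae (hx0.mono fun y hy => Real.norm_of_nonneg hy)).trans hx1
    simp only [Pi.mul_apply, norm_mul, integral_mul_const, hnorm, one_mul]

theorem integrable [IsFiniteMeasure κ] (hΨ : IsTransitionDensity κ ν A Ψ) :
    Integrable Ψ (κ.prod ν) := by
  simpa only [mul_one] using hΨ.integrable_mul_fst (integrable_const (1 : ℝ))

theorem integrable_mul_mul (hΨ : IsTransitionDensity κ ν A Ψ) (hρ : Integrable ρ κ)
    (hu : MemLp u ∞ ν) : Integrable (fun p => Ψ p * ρ p.1 * u p.2) (κ.prod ν) :=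
  (hΨ.integrable_mul_fst hρ).mul_bdd (c := lpNorm u ∞ ν) hu.aestronglyMeasurable.comp_snd
    (Measure.quasiMeasurePreserving_snd.ae (ae_le_lpNorm_exponent_top hu))

theorem integral_le (hΨ : IsTransitionDensity κ ν {p | u p.2 ≤ c p.1} Ψ) (hρ : Integrable ρ κ)
    (hρ0 : 0 ≤ᵐ[κ] ρ) (hu : MemLp u ∞ ν) (hcρ : Integrable (fun x => c x * ρ x) κ) :
    ∫ x, ∫ y, Ψ (x, y) * ρ x * u y ∂ν ∂κ ≤ ∫ x, c x * ρ x ∂κ := by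
  refine integral_mono_ae (hΨ.integrable_mul_mul hρ hu).integral_prod_left hcρ ?_
  filter_upwards [Measure.ae_ae_of_ae_prod hΨ.nonneg, hΨ.integral_eq_one, hΨ.mem_of_ne_zero,
    hρ0] with x h0 h1 hmem hρx
  simp only [mul_right_comm _ (ρ x), integral_mul_const]
  refine mul_le_mul_of_nonneg_right (integral_mul_le_of_integral_eq_one h0 h1 ?_ hmem) hρx
  exact (integrable_of_integral_eq_one h1).mul_bdd hu.aestronglyMeasurable
    (ae_le_lpNorm_exponent_top hu)

theorem le_integral (hΨ : IsTransitionDensity κ ν {p | c p.1 ≤ u p.2} Ψ) (hρ : Integrable ρ κ)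
    (hρ0 : 0 ≤ᵐ[κ] ρ) (hu : MemLp u ∞ ν) (hcρ : Integrable (fun x => c x * ρ x) κ) :
    ∫ x, c x * ρ x ∂κ ≤ ∫ x, ∫ y, Ψ (x, y) * ρ x * u y ∂ν ∂κ := by
  have hneg : IsTransitionDensity κ ν {p | (-u) p.2 ≤ (-c) p.1} Ψ := by
    simpa only [Pi.neg_apply, neg_le_neg_iff] using hΨ
  simpa only [Pi.neg_apply, neg_mul, mul_neg, integral_neg, neg_le_neg_iff] using
    hneg.integral_le hρ hρ0 hu.neg (by simp only [Pi.neg_apply, neg_mul]; exact hcρ.neg)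

end IsTransitionDensity

/-- The transition density whose measure at `x` is the uniform distribution on the section
`{y | (x, y) ∈ B}`. It is meaningful at those `x` whose section has positive finite measure. -/
noncomputable def uniformDensity (ν : Measure Y) (B : Set (X × Y)) : X × Y → ℝ :=
  B.indicator fun p => (ν.real (Prod.mk p.1 ⁻¹' B))⁻¹

variable [SFinite ν]

theorem isTransitionDensity_uniformDensity (hB : MeasurableSet B)
    (hB0 : ∀ᵐ x ∂κ, ν (Prod.mk x ⁻¹' B) ≠ 0) (hBtop : ∀ᵐ x ∂κ, ν (Prod.mk x ⁻¹' B) ≠ ∞) :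
    IsTransitionDensity κ ν B (uniformDensity ν B) where
  aestronglyMeasurable :=
    (((measurable_measure_prodMk_left hB).ennreal_toReal.comp measurable_fst).inv.indicator
      hB).aestronglyMeasurable
  nonneg := ae_of_all _ <| indicator_nonneg fun _ _ => inv_nonneg.2 measureReal_nonneg
  integral_eq_one := by
    filter_upwards [hB0, hBtop] with x hx0 hxtop
    calc
      ∫ y, uniformDensity ν B (x, y) ∂ν
          = ∫ y, (Prod.mk x ⁻¹' B).indicator (fun _ => (ν.real (Prod.mk x ⁻¹' B))⁻¹) y ∂ν := rfl
      _ = ν.real (Prod.mk x ⁻¹' B) * (ν.real (Prod.mk x ⁻¹' B))⁻¹ := by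
        rw [integral_indicator_const _ (measurable_prodMk_left hB), smul_eq_mul]
      _ = 1 := mul_inv_cancel₀ (ENNReal.toReal_ne_zero.2 ⟨hx0, hxtop⟩)
  mem_of_ne_zero := ae_of_all κ fun x => ae_of_all ν fun y => mem_of_indicator_ne_zero

theorem measurable_essSup_restrict_section (hA : MeasurableSet A) (hu : MemLp u ∞ ν) :
    Measurable fun x => essSup u (ν.restrict (Prod.mk x ⁻¹' A)) := by
  wlog hum : Measurable u generalizing u
  · obtain ⟨v, hv, huv⟩ := hu.aestronglyMeasurable
    simpa only [fun x => essSup_congr_ae (ae_restrict_of_ae (s := Prod.mk x ⁻¹' A) huv)]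
      using this ((memLp_congr_ae huv).1 hu) hv.measurable
  refine measurable_of_Ioi fun t => ?_
  have hcut : MeasurableSet (A ∩ Prod.snd ⁻¹' {y | t < u y}) :=
    hA.inter (measurable_snd (measurableSet_lt measurable_const hum))
  -- On a null section the essential supremum is taken over the zero measure, where it is `0`.
  have hpre : (fun x => essSup u (ν.restrict (Prod.mk x ⁻¹' A))) ⁻¹' Ioi t =
      {x | ν (Prod.mk x ⁻¹' (A ∩ Prod.snd ⁻¹' {y | t < u y})) ≠ 0} ∪
        {x | ν (Prod.mk x ⁻¹' A) = 0 ∧ t < 0} := by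
    ext x
    by_cases hx : ν (Prod.mk x ⁻¹' A) = 0
    · have hcut0 : ν (Prod.mk x ⁻¹' (A ∩ Prod.snd ⁻¹' {y | t < u y})) = 0 :=
        measure_mono_null (preimage_mono inter_subset_left) hx
      simp only [mem_preimage, mem_Ioi, Measure.restrict_eq_zero.2 hx, essSup_eq_sInf,
        Measure.coe_zero, Pi.zero_apply, ofPred_true, Real.sInf_univ, mem_union, mem_ofPred_eq, hx,
        hcut0, ne_eq, not_true_eq_false, true_and, false_or]
    · simp only [mem_preimage, mem_Ioi, lt_essSup_restrict_iff hu (measurable_prodMk_left hA) hx,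
        mem_union, mem_ofPred_eq, hx, false_and, or_false]
      rfl
  rw [hpre]
  exact (measurable_measure_prodMk_left hcut (measurableSet_singleton 0).compl).union
    ((measurable_measure_prodMk_left hA (measurableSet_singleton 0)).inter (.const _))

theorem integrable_essSup_restrict_section_mul (hA : MeasurableSet A)
    (hA0 : ∀ᵐ x ∂κ, ν (Prod.mk x ⁻¹' A) ≠ 0) (hρ : Integrable ρ κ) (hu : MemLp u ∞ ν) :
    Integrable (fun x => essSup u (ν.restrict (Prod.mk x ⁻¹' A)) * ρ x) κ := by
  refine hρ.bdd_mul (c := lpNorm u ∞ ν)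
    (measurable_essSup_restrict_section hA hu).aestronglyMeasurable ?_
  filter_upwards [hA0] with x hx
  exact abs_essSup_le_of_ae_abs_le (Measure.restrict_eq_zero.not.2 hx)
    (ae_restrict_of_ae (ae_le_lpNorm_exponent_top hu))

theorem integrable_essInf_restrict_section_mul (hA : MeasurableSet A)
    (hA0 : ∀ᵐ x ∂κ, ν (Prod.mk x ⁻¹' A) ≠ 0) (hρ : Integrable ρ κ) (hu : MemLp u ∞ ν) :
    Integrable (fun x => essInf u (ν.restrict (Prod.mk x ⁻¹' A)) * ρ x) κ := by
  have hneg := (integrable_essSup_restrict_section_mul hA hA0 hρ hu.neg).neg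
  simp only [essSup_neg_eq_neg_essInf, neg_mul] at hneg
  exact hneg.congr (ae_of_all κ fun _ => neg_neg _)

theorem exists_isTransitionDensity_essSup_sub_le (hA : MeasurableSet A)
    (hA0 : ∀ᵐ x ∂κ, ν (Prod.mk x ⁻¹' A) ≠ 0) (hAtop : ∀ᵐ x ∂κ, ν (Prod.mk x ⁻¹' A) ≠ ∞)
    (hu : MemLp u ∞ ν) {δ : ℝ} (hδ : 0 < δ) :
    ∃ Ψ, IsTransitionDensity κ ν A Ψ ∧ IsTransitionDensity κ ν
      {p | essSup u (ν.restrict (Prod.mk p.1 ⁻¹' A)) - δ ≤ u p.2} Ψ := by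
  obtain ⟨v, hv, huv⟩ := hu.aestronglyMeasurable
  let S x := essSup u (ν.restrict (Prod.mk x ⁻¹' A))
  have hB : MeasurableSet (A ∩ {p | S p.1 - δ < v p.2}) :=
    hA.inter (measurableSet_lt
      (((measurable_essSup_restrict_section hA hu).comp measurable_fst).sub_const δ)
      (hv.measurable.comp measurable_snd))
  have hB0 : ∀ᵐ x ∂κ, ν (Prod.mk x ⁻¹' (A ∩ {p | S p.1 - δ < v p.2})) ≠ 0 := by
    filter_upwards [hA0] with x hx
    have hSv : S x = essSup v (ν.restrict (Prod.mk x ⁻¹' A)) :=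
      essSup_congr_ae (ae_restrict_of_ae huv)
    exact (lt_essSup_restrict_iff ((memLp_congr_ae huv).1 hu) (measurable_prodMk_left hA) hx).1
      ((sub_lt_self (S x) hδ).trans_eq hSv)
  have hBtop : ∀ᵐ x ∂κ, ν (Prod.mk x ⁻¹' (A ∩ {p | S p.1 - δ < v p.2})) ≠ ∞ := by
    filter_upwards [hAtop] with x hx
      using measure_ne_top_of_subset (preimage_mono inter_subset_left) hx
  have hΨ := isTransitionDensity_uniformDensity hB hB0 hBtop
  refine ⟨_, hΨ.mono_ae (ae_of_all κ fun x => ae_of_all ν fun y hxy => hxy.1),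
    hΨ.mono_ae (ae_of_all κ fun x => huv.mono fun y hy hxy => ?_)⟩
  exact hxy.2.le.trans_eq hy.symm

theorem isLUB_integral_isTransitionDensity (hA : MeasurableSet A)
    (hA0 : ∀ᵐ x ∂κ, ν (Prod.mk x ⁻¹' A) ≠ 0) (hAtop : ∀ᵐ x ∂κ, ν (Prod.mk x ⁻¹' A) ≠ ∞)
    (hρ : Integrable ρ κ) (hρ0 : 0 ≤ᵐ[κ] ρ) (hu : MemLp u ∞ ν) :
    IsLUB ((fun Ψ : X × Y → ℝ => ∫ x, ∫ y, Ψ (x, y) * ρ x * u y ∂ν ∂κ) ''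
        {Ψ | IsTransitionDensity κ ν A Ψ})
      (∫ x, essSup u (ν.restrict (Prod.mk x ⁻¹' A)) * ρ x ∂κ) := by
  have hSρ := integrable_essSup_restrict_section_mul hA hA0 hρ hu
  refine ⟨?_, fun b hb => ?_⟩
  · rintro _ ⟨Ψ, hΨ, rfl⟩
    have hle (x : X) : ∀ᵐ y ∂ν, (x, y) ∈ A → u y ≤ essSup u (ν.restrict (Prod.mk x ⁻¹' A)) :=
      (ae_restrict_iff' (measurable_prodMk_left hA)).1 (ae_le_essSup
        (isBoundedUnder_le_abs.1 (isBoundedUnder_abs_of_memLp_top (hu.restrict _))).1)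
    exact (hΨ.mono_ae (ae_of_all κ hle)).integral_le hρ hρ0 hu hSρ
  · have hsub : ∀ δ > 0,
        ∫ x, essSup u (ν.restrict (Prod.mk x ⁻¹' A)) * ρ x ∂κ - δ * ∫ x, ρ x ∂κ ≤ b := by
      intro δ hδ
      obtain ⟨Ψ, hΨA, hΨu⟩ :=
        exists_isTransitionDensity_essSup_sub_le hA hA0 hAtop hu hδ
      calc
        ∫ x, essSup u (ν.restrict (Prod.mk x ⁻¹' A)) * ρ x ∂κ - δ * ∫ x, ρ x ∂κ
            = ∫ x, (essSup u (ν.restrict (Prod.mk x ⁻¹' A)) - δ) * ρ x ∂κ := by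
          simp only [sub_mul]
          rw [integral_sub hSρ (hρ.const_mul δ), integral_const_mul]
        _ ≤ ∫ x, ∫ y, Ψ (x, y) * ρ x * u y ∂ν ∂κ :=
          hΨu.le_integral (c := fun x => essSup u (ν.restrict (Prod.mk x ⁻¹' A)) - δ) hρ hρ0 hu
            (by simp only [sub_mul]; exact hSρ.sub (hρ.const_mul δ))
        _ ≤ b := hb (mem_image_of_mem _ hΨA)
    refine le_of_tendsto (x := nhdsWithin 0 (Ioi 0)) ?_ (eventually_mem_nhdsWithin.mono hsub)
    exact (Continuous.tendsto' (by fun_prop) 0 _ (by simp)).mono_left nhdsWithin_le_nhds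

theorem isGLB_integral_isTransitionDensity (hA : MeasurableSet A)
    (hA0 : ∀ᵐ x ∂κ, ν (Prod.mk x ⁻¹' A) ≠ 0) (hAtop : ∀ᵐ x ∂κ, ν (Prod.mk x ⁻¹' A) ≠ ∞)
    (hρ : Integrable ρ κ) (hρ0 : 0 ≤ᵐ[κ] ρ) (hu : MemLp u ∞ ν) :
    IsGLB ((fun Ψ : X × Y → ℝ => ∫ x, ∫ y, Ψ (x, y) * ρ x * u y ∂ν ∂κ) ''
        {Ψ | IsTransitionDensity κ ν A Ψ})
      (∫ x, essInf u (ν.restrict (Prod.mk x ⁻¹' A)) * ρ x ∂κ) := by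
  have hlub := isLUB_integral_isTransitionDensity hA hA0 hAtop hρ hρ0 hu.neg
  simp only [essSup_neg_eq_neg_essInf, Pi.neg_apply, neg_mul, mul_neg, integral_neg] at hlub
  rw [← isGLB_neg, ← image_neg_eq_neg, image_image] at hlub
  simpa only [neg_neg] using hlub

end TransitionDensity

theorem essSupport_subset_iff {X : Type*} [TopologicalSpace X] [SecondCountableTopology X]
    [MeasurableSpace X] [OpensMeasurableSpace X] {ν : Measure X} {f : X → ℝ} {C : Set X}
    (hC : IsClosed C) : essSupport ν f ⊆ C ↔ ∀ᵐ y ∂ν, f y ≠ 0 → y ∈ C := by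
  constructor
  · intro hsub
    obtain ⟨T, hTc, hTS, hTU⟩ := TopologicalSpace.isOpen_sUnion_countable
      {U : Set X | IsOpen U ∧ ∀ᵐ y ∂(ν.restrict U), f y = 0} fun U hU => hU.1
    have hzero : ∀ᵐ y ∂ν, ∀ U ∈ T, y ∈ U → f y = 0 :=
      (ae_ball_iff hTc).2 fun U hU => (ae_restrict_iff' (hTS hU).1.measurableSet).1 (hTS hU).2
    filter_upwards [hzero] with y hy hfy
    refine hsub fun hmem => ?_
    obtain ⟨U, hU, hyU⟩ := hTU.symm ▸ hmem
    exact hfy (hy U hU hyU)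
  · intro hmem
    refine compl_subset_comm.1 (subset_sUnion_of_mem ⟨hC.isOpen_compl, ?_⟩)
    exact (ae_restrict_iff' hC.isOpen_compl.measurableSet).2
      (hmem.mono fun y hy => not_imp_comm.1 hy)

section Ball

/-- The pairs `(x, y)` with `y ∈ B_ε(x)`, so that the section at `x` is `B_ε(x)`. -/
def ballGraph (X : Type*) [PseudoMetricSpace X] (ε : ℝ) : Set (X × X) :=
  {p | p.2 ∈ Metric.ball p.1 ε}

variable {X : Type*} [PseudoMetricSpace X]

theorem mk_preimage_ballGraph (x : X) (ε : ℝ) :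
    Prod.mk x ⁻¹' ballGraph X ε = Metric.ball x ε := rfl

theorem measurableSet_ballGraph [SecondCountableTopology X] [MeasurableSpace X]
    [OpensMeasurableSpace X] (ε : ℝ) :
    MeasurableSet (ballGraph X ε) :=
  measurableSet_lt (measurable_snd.dist measurable_fst) measurable_const

theorem ae_measure_ball_ne_zero [HereditarilyLindelofSpace X] [MeasurableSpace X]
    (ν : Measure X) {ε : ℝ} (hε : 0 < ε) : ∀ᵐ x ∂ν, ν (Metric.ball x ε) ≠ 0 := by
  filter_upwards [Measure.support_mem_ae (μ := ν)] with x hx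
  exact ((Measure.mem_support_iff_forall x).1 hx _ (Metric.ball_mem_nhds x hε)).ne'

theorem ae_restrict_mem_closedBall_inter_closure_iff {E : Type*} [NormedAddCommGroup E]
    [NormedSpace ℝ E] [FiniteDimensional ℝ E] [MeasurableSpace E] [BorelSpace E] (ν : Measure E)
    [ν.IsAddHaarMeasure] (s : Set E) (x : E) {ε : ℝ} (hε : ε ≠ 0) :
    ∀ᵐ y ∂ν.restrict s, y ∈ Metric.closedBall x ε ∩ closure s ↔ y ∈ Metric.ball x ε := by
  have hsphere : ∀ᵐ y ∂ν.restrict s, y ∉ Metric.sphere x ε :=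
    ae_restrict_of_ae (measure_eq_zero_iff_ae_notMem.1 (Measure.addHaar_sphere_of_ne_zero ν x hε))
  have hclosure : ∀ᵐ y ∂ν.restrict s, y ∈ closure s :=
    ae_restrict_of_ae_restrict_of_subset subset_closure
      (ae_restrict_mem isClosed_closure.measurableSet)
  filter_upwards [hsphere, hclosure] with y hy hys
  exact ⟨fun h => lt_of_le_of_ne h.1 hy, fun h => ⟨Metric.ball_subset_closedBall h, hys⟩⟩

end Ball

section TestFunctions

variable {N : ℕ} {Ω : Set (EuclideanSpace ℝ (Fin N))} {ε : ℝ}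

theorem testFunctions_eq_setOf_isTransitionDensity (hΩ : volume Ω ≠ ∞) (hε : ε ≠ 0) :
    testFunctions Ω ε = {Ψ | IsTransitionDensity (volume.restrict Ω) (volume.restrict Ω)
      (ballGraph (EuclideanSpace ℝ (Fin N)) ε) Ψ} := by
  have : Fact (volume Ω < ∞) := ⟨hΩ.lt_top⟩
  have hsupp (f : EuclideanSpace ℝ (Fin N) → ℝ) (x : EuclideanSpace ℝ (Fin N)) :
      essSupport (volume.restrict Ω) f ⊆ Metric.closedBall x ε ∩ closure Ω ↔
        ∀ᵐ y ∂volume.restrict Ω, f y ≠ 0 → (x, y) ∈ ballGraph _ ε := by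
    rw [essSupport_subset_iff (Metric.isClosed_closedBall.inter isClosed_closure)]
    refine eventually_congr ?_
    filter_upwards [ae_restrict_mem_closedBall_inter_closure_iff volume Ω x hε] with y hy
    exact imp_congr_right fun _ => hy
  ext Ψ
  simp only [testFunctions, hsupp, memLp_one_iff_integrable]
  constructor
  · rintro ⟨hint, hnonneg, hone, hmem⟩
    exact ⟨hint.aestronglyMeasurable, hnonneg, hone, hmem⟩
  · intro hΨ
    exact ⟨hΨ.integrable, hΨ.nonneg, hΨ.integral_eq_one, hΨ.mem_of_ne_zero⟩

theorem integrable_density (μ : Measure (Ω × Fin 2)) [IsFiniteMeasure μ] (i : Fin 2) :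
    Integrable (density μ i) := by
  have : IsFiniteMeasure (condDistr μ i) := by unfold condDistr; infer_instance
  exact Measure.integrable_toReal_rnDeriv

theorem density_nonneg (μ : Measure (Ω × Fin 2)) (i : Fin 2) : 0 ≤ density μ i :=
  fun _ => ENNReal.toReal_nonneg

end TestFunctions

end AdversarialTV

open MeasureTheory AdversarialTV in
theorem mainTheorem5_general {N : ℕ} {Ω : Set (EuclideanSpace ℝ (Fin N))} (hΩ : volume Ω ≠ ⊤)
    {ε : ℝ} (hε : 0 < ε) {ρ : EuclideanSpace ℝ (Fin N) → ℝ} (hρ : IntegrableOn ρ Ω)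
    (hρ0 : 0 ≤ᵐ[volume.restrict Ω] ρ) {u : EuclideanSpace ℝ (Fin N) → ℝ}
    (hu : MemLp u ⊤ (volume.restrict Ω)) :
    IntegrableOn (fun x => essSup u (volume.restrict (Metric.ball x ε ∩ Ω)) * ρ x) Ω ∧
    IntegrableOn (fun x => essInf u (volume.restrict (Metric.ball x ε ∩ Ω)) * ρ x) Ω ∧
    (∀ Ψ ∈ testFunctions Ω ε, Integrable (fun p => Ψ p * ρ p.1 * u p.2)
      ((volume.restrict Ω).prod (volume.restrict Ω))) ∧
    IsLUB ((fun Ψ => ∫ x in Ω, ∫ y in Ω, Ψ (x, y) * ρ x * u y) '' testFunctions Ω ε)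
      (∫ x in Ω, essSup u (volume.restrict (Metric.ball x ε ∩ Ω)) * ρ x) ∧
    IsGLB ((fun Ψ => ∫ x in Ω, ∫ y in Ω, Ψ (x, y) * ρ x * u y) '' testFunctions Ω ε)
      (∫ x in Ω, essInf u (volume.restrict (Metric.ball x ε ∩ Ω)) * ρ x) := by
  have : Fact (volume Ω < ⊤) := ⟨hΩ.lt_top⟩
  have hA := measurableSet_ballGraph (X := EuclideanSpace ℝ (Fin N)) ε
  have hA0 := ae_measure_ball_ne_zero (volume.restrict Ω) hε
  have hAtop := ae_of_all (volume.restrict Ω) fun x =>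
    measure_ne_top (volume.restrict Ω) (Metric.ball x ε)
  simp only [← mk_preimage_ballGraph] at hA0 hAtop
  simp only [← Measure.restrict_restrict measurableSet_ball]
  simp only [← mk_preimage_ballGraph, testFunctions_eq_setOf_isTransitionDensity hΩ hε.ne']
  exact ⟨integrable_essSup_restrict_section_mul hA hA0 hρ hu,
    integrable_essInf_restrict_section_mul hA hA0 hρ hu,
    fun _ hΨ => hΨ.integrable_mul_mul hρ hu,
    isLUB_integral_isTransitionDensity hA hA0 hAtop hρ hρ0 hu,
    isGLB_integral_isTransitionDensity hA hA0 hAtop hρ hρ0 hu⟩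

open MeasureTheory AdversarialTV in
theorem mainTheorem5 {N : ℕ} (Ω : Set (EuclideanSpace ℝ (Fin N)))
    (hΩ_open : IsOpen Ω) (hΩ_bdd : Bornology.IsBounded Ω) (hΩ_conv : Convex ℝ Ω)
    (ε : ℝ) (hε : 0 < ε)
    (μ : Measure (Ω × Fin 2)) [IsProbabilityMeasure μ]
    (hμ : ∀ i : Fin 2, condDistr μ i ≪ volume)
    (u : EuclideanSpace ℝ (Fin N) → ℝ) (hu : MemLp u ⊤ (volume.restrict Ω)) :
    -- all integrals below are well defined
    (IntegrableOn
        (fun x => essSup u (volume.restrict (Metric.ball x ε ∩ Ω)) * density μ 0 x) Ω ∧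
      IntegrableOn
        (fun x => essInf u (volume.restrict (Metric.ball x ε ∩ Ω)) * density μ 1 x) Ω ∧
      ∀ Ψ ∈ testFunctions Ω ε, ∀ i : Fin 2,
        Integrable (fun p => Ψ p * density μ i p.1 * u p.2)
          ((volume.restrict Ω).prod (volume.restrict Ω))) ∧
    -- the supremum formula
    IsLUB
      ((fun Ψ => ∫ x in Ω, ∫ y in Ω, Ψ (x, y) * density μ 0 x * u y) '' testFunctions Ω ε)
      (∫ x in Ω, essSup u (volume.restrict (Metric.ball x ε ∩ Ω)) * density μ 0 x) ∧
    -- the infimum formula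
    IsGLB
      ((fun Ψ => ∫ x in Ω, ∫ y in Ω, Ψ (x, y) * density μ 1 x * u y) '' testFunctions Ω ε)
      (∫ x in Ω, essInf u (volume.restrict (Metric.ball x ε ∩ Ω)) * density μ 1 x) := by
  have h i := mainTheorem5_general hΩ_bdd.measure_lt_top.ne hε (integrable_density μ i).integrableOn
    (ae_of_all _ (density_nonneg μ i)) hu
  exact ⟨⟨(h 0).1, (h 1).2.1, fun Ψ hΨ i => (h i).2.2.1 Ψ hΨ⟩, (h 0).2.2.2.1, (h 1).2.2.2.2⟩
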